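/- Let $1\le k\le n$ be integers, let $0<q\le 2$, and let $f,g:\mathbb R\to\mathbb R$ be continuous, nonnegative and nondecreasing, with $f$ positive and strictly increasing. If $q>1$, assume in addition that $g$ is not identically zero. For a symmetric $n\times n$ real matrix $X$ with eigenvalues $\mu_1(X)\le\dots\le\mu_n(X)$, let $\mathcal P^+_k(X)=\mu_{n-k+1}(X)+\dots+\mu_n(X)$ be the sum of its $k$ largest eigenvalues. Then the following are equivalent. (a) There is an entire upper semicontinuous viscosity subsolution of $\mathcal P^+_k(D^2u)=f(u)+g(u)\,|Du|^q$ in $\mathbb R^n$, that is, an upper semicontinuous function $u:\mathbb R^n\to\mathbb R$ such that, whenever $\varphi$ is of class $C^2$ in a neighbourhood of a point $x\in\mathbb R^n$ and $u-\varphi$ has a local maximum at $x$, $$\mathcal P^+_k(D^2\varphi(x))\ \ge\ f(u(x))+g(u(x))\,|D\varphi(x)|^q .$$ (b) $$q\le 1\qquad\text{and}\qquad \int_0^{+\infty}\frac{dt}{(t\,f(t))^{1/2}+(t\,g^+(t))^{1/(2-q)}}=+\infty ,$$ where $g^+=\max(g,0)$. -/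

import Mathlib

open scoped Gradient

/-- The space `ℝⁿ` with its Euclidean norm. -/
abbrev Rn (n : ℕ) : Type := EuclideanSpace ℝ (Fin n)

/-- The Hessian matrix `D²φ(x)`, whose `(i, j)` entry is the second derivative of `φ` at `x`
in the directions of the standard basis vectors `eᵢ` and `eⱼ`. -/
noncomputable def hessian {n : ℕ} (φ : Rn n → ℝ) (x : Rn n) : Matrix (Fin n) (Fin n) ℝ :=
  Matrix.of fun i j =>
    fderiv ℝ (fderiv ℝ φ) x (EuclideanSpace.single i 1) (EuclideanSpace.single j 1)

/-- The Hessian of a function of class `C²` near `x` is a symmetric matrix. -/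
theorem hessian_isHermitian {n : ℕ} {φ : Rn n → ℝ} {x : Rn n} (hφ : ContDiffAt ℝ 2 φ x) :
    (hessian φ x).IsHermitian := by
  ext i j
  have h : IsSymmSndFDerivAt ℝ φ x := hφ.isSymmSndFDerivAt (by simp)
  simpa [hessian] using h.eq _ _

/-- `𝒫⁺ₖ(A)`, the sum of the `k` largest eigenvalues (counted with multiplicity) of the symmetric
matrix `A`. Mathlib's `eigenvalues₀` lists the eigenvalues in decreasing order. -/
noncomputable def sumLargestEigenvalues {n : ℕ} (k : ℕ) (A : Matrix (Fin n) (Fin n) ℝ)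
    (hA : A.IsHermitian) : ℝ :=
  ∑ i : Fin (Fintype.card (Fin n)) with i.val < k, hA.eigenvalues₀ i

/-- `u` is an entire viscosity subsolution of `𝒫⁺ₖ(D²u) = f(u) + g(u) |Du|^q` in `ℝⁿ`: it is upper
semicontinuous, and whenever `u - φ` has a local maximum at `x`, where `φ` is of class `C²` in a
neighbourhood of `x`, one has `𝒫⁺ₖ(D²φ(x)) ≥ f(u(x)) + g(u(x)) |Dφ(x)|^q`. -/
def IsEntireViscositySubsolution {n : ℕ} (k : ℕ) (f g : ℝ → ℝ) (q : ℝ) (u : Rn n → ℝ) : Prop :=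
  UpperSemicontinuous u ∧
    ∀ (φ : Rn n → ℝ) (x : Rn n) (hφ : ContDiffAt ℝ 2 φ x),
      IsLocalMax (fun y => u y - φ y) x →
        f (u x) + g (u x) * ‖∇ φ x‖ ^ q
          ≤ sumLargestEigenvalues k (hessian φ x) (hessian_isHermitian hφ)

/-! Both directions reduce to the motion `V'' = e(V)` started at rest. Conservation of energy gives
`V' = speed e a V`, so `V` is the inverse of `travelTime`, and `V` is global exactly when the travel
time to infinity is infinite. For suitable forces `e` the squared speed is comparable, up to
constants and a rescaling of `t`, to `t f(t) + (t g(t))^(2/(2-q))`; this turns the Keller–Osserman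
integral into the total travel time.

Existence: if `e` dominates `f + g * speed^q` and the motion is global, `V` of a single coordinate
is a subsolution, because its only nonzero second derivative is `V'' = e(V)` (`exists_force_le`,
`mem_lifespan_of_lintegral_eq_top`, `exists_isEntireViscositySubsolution`).

Nonexistence: if `(k + 1) e` is at most `f + g * speed^q` and the total travel time is finite, the
radial function `V(|x - x₀|)` blows up at a finite radius. Its Hessian has eigenvalues `V''` and
`V'/r ≤ V''`, so it is a supersolution, and comparison on a ball gives `u x₀ ≤ a` for every centre
`x₀` (`le_of_travelTime_bounded`). Since subsolutions are unbounded above (`exists_lt`), there are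
none. The force comes from `exists_force_travelTime_le`; when `q > 1`, constant `f` and `g` already
give a convergent integral. -/

/-! ### Hessians and sums of largest eigenvalues. -/

/-- The quadratic form of the Hessian matrix is the second derivative. -/
theorem dotProduct_hessian_mulVec {n : ℕ} (φ : Rn n → ℝ) (x v : Rn n) :
    v.ofLp ⬝ᵥ (hessian φ x).mulVec v.ofLp = fderiv ℝ (fderiv ℝ φ) x v v := by
  have hv : v = ∑ i, v i • EuclideanSpace.single i (1 : ℝ) := by
    simpa using ((EuclideanSpace.basisFun (Fin n) ℝ).sum_repr v).symm
  conv_rhs => rw [hv]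
  simp only [map_sum, map_smul, _root_.sum_apply, _root_.smul_apply,
    dotProduct, Matrix.mulVec, hessian, Matrix.of_apply, Finset.mul_sum, smul_eq_mul]
  rw [Finset.sum_comm]
  refine Finset.sum_congr rfl fun i _ => Finset.sum_congr rfl fun j _ => ?_
  ring

theorem eigenvalues_hessian_eq {n : ℕ} {φ : Rn n → ℝ} {x : Rn n}
    (hA : (hessian φ x).IsHermitian) (i : Fin n) :
    hA.eigenvalues i =
      fderiv ℝ (fderiv ℝ φ) x (hA.eigenvectorBasis i) (hA.eigenvectorBasis i) := by
  rw [hA.eigenvalues_eq, ← dotProduct_hessian_mulVec]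
  simp

theorem exists_eigenvalues_eq_eigenvalues₀ {n : ℕ} {A : Matrix (Fin n) (Fin n) ℝ}
    (hA : A.IsHermitian) (i : Fin (Fintype.card (Fin n))) :
    hA.eigenvalues₀ i =
      hA.eigenvalues (Fintype.equivOfCardEq (α := Fin (Fintype.card (Fin n))) (β := Fin n)
        (Fintype.card_fin _) i) := by
  simp [Matrix.IsHermitian.eigenvalues]

/-- If the second derivative of `φ` at `x` is bounded above by `α |v|² + β ⟨y, v⟩²`, then
`𝒫⁺ₖ(D²φ(x)) ≤ k α + β |y|²`. -/
theorem sumLargestEigenvalues_hessian_le {n k : ℕ} {φ : Rn n → ℝ} {x : Rn n}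
    (hA : (hessian φ x).IsHermitian) {α β : ℝ} (hα : 0 ≤ α) (hβ : 0 ≤ β) (y : Rn n)
    (h : ∀ v, fderiv ℝ (fderiv ℝ φ) x v v ≤ α * ‖v‖ ^ 2 + β * inner ℝ y v ^ 2) :
    sumLargestEigenvalues k (hessian φ x) hA ≤ k * α + β * ‖y‖ ^ 2 := by
  set b := hA.eigenvectorBasis
  set σ := Fintype.equivOfCardEq (α := Fin (Fintype.card (Fin n))) (β := Fin n)
    (Fintype.card_fin _)
  have key : ∀ i : Fin (Fintype.card (Fin n)),
      hA.eigenvalues₀ i ≤ α + β * inner ℝ y (b (σ i)) ^ 2 := by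
    intro i
    rw [exists_eigenvalues_eq_eigenvalues₀, eigenvalues_hessian_eq]
    refine (h _).trans_eq ?_
    simp [b, σ, hA.eigenvectorBasis.orthonormal.1]
  have hcard : ((Finset.univ.filter fun i : Fin (Fintype.card (Fin n)) => i.val < k).card : ℝ)
      ≤ k := by
    have : (Finset.univ.filter fun i : Fin (Fintype.card (Fin n)) => i.val < k).card
        ≤ (Finset.range k).card :=
      Finset.card_le_card_of_injOn (fun i => i.val) (by intro i; simp)
        (Fin.val_injective.injOn)
    simpa using (Nat.cast_le (α := ℝ)).2 this
  -- Parseval: the rank-one part contributes at most its full trace, whichever eigenvectors are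
  -- selected.
  have hbessel : ∑ i : Fin (Fintype.card (Fin n)), inner ℝ y (b (σ i)) ^ 2 = ‖y‖ ^ 2 := by
    rw [Equiv.sum_comp σ fun j => inner ℝ y (b j) ^ 2, ← real_inner_self_eq_norm_sq,
      ← b.sum_inner_mul_inner y y]
    refine Finset.sum_congr rfl fun j _ => ?_
    rw [real_inner_comm y (b j), sq]
  calc sumLargestEigenvalues k (hessian φ x) hA
      ≤ ∑ i : Fin (Fintype.card (Fin n)) with i.val < k, (α + β * inner ℝ y (b (σ i)) ^ 2) :=
        Finset.sum_le_sum fun i _ => key i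
    _ ≤ k * α + β * ∑ i : Fin (Fintype.card (Fin n)), inner ℝ y (b (σ i)) ^ 2 := by
        rw [Finset.sum_add_distrib, Finset.sum_const, nsmul_eq_mul, Finset.mul_sum]
        refine add_le_add (mul_le_mul_of_nonneg_right hcard hα) ?_
        exact Finset.sum_le_sum_of_subset_of_nonneg (Finset.filter_subset _ _)
          fun i _ _ => by positivity
    _ = _ := by rw [hbessel]

/-- A diagonal entry of a positive semidefinite matrix is at most the sum of its `k ≥ 1` largest
eigenvalues. -/
theorem apply_self_le_sumLargestEigenvalues {n k : ℕ} (hk : 1 ≤ k)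
    {A : Matrix (Fin n) (Fin n) ℝ} (hA : A.IsHermitian) (hpos : ∀ i, 0 ≤ hA.eigenvalues i)
    (i : Fin n) : A i i ≤ sumLargestEigenvalues k A hA := by
  have hn : 0 < Fintype.card (Fin n) := by simpa using i.pos
  set b := hA.eigenvectorBasis
  have hle : ∀ j, hA.eigenvalues j ≤ hA.eigenvalues₀ ⟨0, hn⟩ := fun j =>
    hA.eigenvalues₀_antitone (Fin.mk_le_of_le_val (Nat.zero_le _))
  have hsum : ∑ j, b j i ^ 2 = 1 := by
    have := b.sum_inner_mul_inner (EuclideanSpace.single i (1 : ℝ)) (EuclideanSpace.single i 1)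
    simpa [EuclideanSpace.inner_single_left, EuclideanSpace.inner_single_right, sq] using this
  -- A diagonal entry is a weighted average of the eigenvalues, hence at most the top one; the other
  -- summands are nonnegative.
  have hAii : A i i = ∑ j, hA.eigenvalues j * b j i ^ 2 := by
    conv_lhs => rw [hA.spectral_theorem]
    simp only [Unitary.conjStarAlgAut_apply, Matrix.mul_apply, Matrix.diagonal_apply,
      Matrix.star_apply, Matrix.IsHermitian.eigenvectorUnitary_apply]
    refine Finset.sum_congr rfl fun j _ => ?_
    simp [b]
    ring
  calc A i i ≤ ∑ j, hA.eigenvalues₀ ⟨0, hn⟩ * b j i ^ 2 := by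
        rw [hAii]
        exact Finset.sum_le_sum fun j _ => mul_le_mul_of_nonneg_right (hle j) (sq_nonneg _)
    _ = hA.eigenvalues₀ ⟨0, hn⟩ := by rw [← Finset.mul_sum, hsum, mul_one]
    _ ≤ sumLargestEigenvalues k A hA := by
        refine Finset.single_le_sum (f := hA.eigenvalues₀) (fun j _ => ?_) ?_
        · rw [exists_eigenvalues_eq_eigenvalues₀]
          exact hpos _
        · simp; omega

/-! ### Radial quartic test functions. -/

/-- The test functions `α |x - x₀|² + β (|x - x₀|² - s)²`. -/
noncomputable def radialQuartic {n : ℕ} (x₀ : Rn n) (α β s : ℝ) (x : Rn n) : ℝ :=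
  α * ‖x - x₀‖ ^ 2 + β * (‖x - x₀‖ ^ 2 - s) ^ 2

theorem contDiff_radialQuartic {n : ℕ} (x₀ : Rn n) (α β s : ℝ) :
    ContDiff ℝ 2 (radialQuartic x₀ α β s) := by
  have h : ContDiff ℝ 2 fun x : Rn n => ‖x - x₀‖ ^ 2 := (contDiff_id.sub contDiff_const).norm_sq ℝ
  exact (contDiff_const.mul h).add (contDiff_const.mul ((h.sub contDiff_const).pow 2))

theorem hasFDerivAt_norm_sub_sq {n : ℕ} (x₀ x : Rn n) :
    HasFDerivAt (fun x : Rn n => ‖x - x₀‖ ^ 2) (2 • innerSL ℝ (x - x₀)) x := by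
  simpa using ((hasFDerivAt_id x).sub_const x₀).norm_sq

theorem hasFDerivAt_radialQuartic {n : ℕ} (x₀ : Rn n) (α β s : ℝ) (x : Rn n) :
    HasFDerivAt (radialQuartic x₀ α β s)
      ((2 * α + 4 * β * (‖x - x₀‖ ^ 2 - s)) • innerSL ℝ (x - x₀)) x := by
  have h := hasFDerivAt_norm_sub_sq x₀ x
  convert! (h.const_mul α).add (((h.sub_const s).pow 2).const_mul β) using 1
  ext v
  simp [-map_sub]
  ring

theorem gradient_radialQuartic {n : ℕ} (x₀ : Rn n) (α β : ℝ) (x : Rn n) :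
    ∇ (radialQuartic x₀ α β (‖x - x₀‖ ^ 2)) x = (2 * α) • (x - x₀) := by
  refine HasGradientAt.gradient ?_
  rw [hasGradientAt_iff_hasFDerivAt]
  convert! hasFDerivAt_radialQuartic x₀ α β (‖x - x₀‖ ^ 2) x using 1
  ext v
  simp

theorem fderiv_fderiv_radialQuartic {n : ℕ} (x₀ : Rn n) (α β : ℝ) (x v : Rn n) :
    fderiv ℝ (fderiv ℝ (radialQuartic x₀ α β (‖x - x₀‖ ^ 2))) x v v
      = 2 * α * ‖v‖ ^ 2 + 8 * β * inner ℝ (x - x₀) v ^ 2 := by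
  set s := ‖x - x₀‖ ^ 2 with hs
  have h1 : fderiv ℝ (radialQuartic x₀ α β s) =
      fun x => (2 * α + 4 * β * (‖x - x₀‖ ^ 2 - s)) • innerSL ℝ (x - x₀) :=
    funext fun x => (hasFDerivAt_radialQuartic x₀ α β s x).fderiv
  have h2 : HasFDerivAt (fun x : Rn n => innerSL ℝ (x - x₀)) (innerSL ℝ (E := Rn n)) x := by
    exact (innerSL ℝ (E := Rn n)).hasFDerivAt.comp x ((hasFDerivAt_id x).sub_const x₀)
  have h3 := ((((hasFDerivAt_norm_sub_sq x₀ x).sub_const s).const_mul (4 * β)).const_add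
    (2 * α)).smul h2
  rw [h1]
  erw [h3.fderiv]
  have h4 : (innerSL ℝ (E := Rn n) v) v = ‖v‖ ^ 2 := real_inner_self_eq_norm_sq v
  have h5 : (innerSL ℝ (E := Rn n) (x - x₀)) v = inner ℝ (x - x₀) v := rfl
  simp only [← hs, sub_self, mul_zero, add_zero, _root_.add_apply, _root_.smul_apply,
    ContinuousLinearMap.smulRight_apply, smul_eq_mul, nsmul_eq_mul, h4, h5]
  push_cast
  ring

/-- A subsolution touched from above by a radial quartic. -/
theorem IsEntireViscositySubsolution.le_of_radialQuartic {n k : ℕ} {f g : ℝ → ℝ} {q : ℝ}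
    {u : Rn n → ℝ} (hu : IsEntireViscositySubsolution k f g q u) {x₀ x : Rn n} {α β : ℝ}
    (hα : 0 ≤ α) (hβ : 0 ≤ β)
    (hmax : IsLocalMax (fun y => u y - radialQuartic x₀ α β (‖x - x₀‖ ^ 2) y) x) :
    f (u x) + g (u x) * (2 * α * ‖x - x₀‖) ^ q
      ≤ k * (2 * α) + 8 * β * ‖x - x₀‖ ^ 2 := by
  have h := hu.2 _ x (contDiff_radialQuartic x₀ α β (‖x - x₀‖ ^ 2)).contDiffAt hmax
  rw [gradient_radialQuartic, norm_smul, Real.norm_of_nonneg (by positivity)] at h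
  exact h.trans (sumLargestEigenvalues_hessian_le _ (by positivity) (by positivity) (x - x₀)
    fun v => (fderiv_fderiv_radialQuartic x₀ α β x v).le)

open Set Filter Topology MeasureTheory

/-! ### The one-dimensional motion `V'' = e(V)`. -/

/-- The kinetic energy gained between the heights `a` and `t` under the force `e`. -/
noncomputable def energy (e : ℝ → ℝ) (a t : ℝ) : ℝ := ∫ τ in a..t, e τ

/-- The speed at height `t` of a motion under the force `e` starting at rest at height `a`. -/
noncomputable def speed (e : ℝ → ℝ) (a t : ℝ) : ℝ := √(2 * energy e a t)

/-- The time needed to climb from height `a` to height `t`, starting at rest. -/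
noncomputable def travelTime (e : ℝ → ℝ) (a t : ℝ) : ℝ := ∫ τ in a..t, (speed e a τ)⁻¹

/-- The even solution of `V'' = e(V)`, `V(0) = a`, `V'(0) = 0`. -/
noncomputable def profile (e : ℝ → ℝ) (a s : ℝ) : ℝ :=
  Function.invFunOn (travelTime e a) (Ici a) |s|

/-- The derivative of `profile e a`. -/
noncomputable def profileDeriv (e : ℝ → ℝ) (a s : ℝ) : ℝ :=
  SignType.sign s * speed e a (profile e a s)

/-- The times before the motion under the force `e` has left every bounded set. -/
def lifespan (e : ℝ → ℝ) (a : ℝ) : Set ℝ := {s | ∃ t, a ≤ t ∧ |s| < travelTime e a t}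

/-- A function differentiable in a punctured neighbourhood of a point, and continuous at it with
its derivative, is differentiable at the point. -/
theorem hasDerivAt_of_eventually_hasDerivAt {f f' : ℝ → ℝ} {x : ℝ}
    (hd : ∀ᶠ y in 𝓝 x, y ≠ x → HasDerivAt f (f' y) y) (hf : ContinuousAt f x)
    (hf' : ContinuousAt f' x) : HasDerivAt f (f' x) x := by
  have A : HasDerivWithinAt f (f' x) (Ici x) x := by
    refine hasDerivWithinAt_Ici_of_tendsto_deriv (s := Ioi x ∩ {y | y ≠ x → HasDerivAt f (f' y) y})
      (fun y hy => (hy.2 hy.1.ne').differentiableAt.differentiableWithinAt)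
      hf.continuousWithinAt (inter_mem_nhdsWithin _ hd) ?_
    refine (hf'.tendsto.mono_left inf_le_left).congr' ?_
    filter_upwards [inter_mem_nhdsWithin _ hd] with y hy using (hy.2 (ne_of_gt hy.1)).deriv.symm
  have B : HasDerivWithinAt f (f' x) (Iic x) x := by
    refine hasDerivWithinAt_Iic_of_tendsto_deriv (s := Iio x ∩ {y | y ≠ x → HasDerivAt f (f' y) y})
      (fun y hy => (hy.2 (ne_of_lt hy.1)).differentiableAt.differentiableWithinAt)
      hf.continuousWithinAt (inter_mem_nhdsWithin _ hd) ?_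
    refine (hf'.tendsto.mono_left inf_le_left).congr' ?_
    filter_upwards [inter_mem_nhdsWithin _ hd] with y hy using (hy.2 (ne_of_lt hy.1)).deriv.symm
  simpa using B.union A

section Energy

variable {e : ℝ → ℝ} {a : ℝ}

theorem energy_self : energy e a a = 0 := by simp [energy]

theorem speed_self : speed e a a = 0 := by simp [speed, energy_self]

theorem speed_nonneg (t : ℝ) : 0 ≤ speed e a t := Real.sqrt_nonneg _

theorem hasDerivAt_energy (he : Continuous e) (t : ℝ) : HasDerivAt (energy e a) (e t) t :=
  he.integral_hasStrictDerivAt a t |>.hasDerivAt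

theorem continuous_energy (he : Continuous e) : Continuous (energy e a) :=
  continuous_iff_continuousAt.2 fun t => (hasDerivAt_energy he t).continuousAt

theorem continuous_speed (he : Continuous e) : Continuous (speed e a) :=
  ((continuous_energy he).const_mul 2).sqrt

theorem mul_sub_le_energy (he : Continuous e) (hmono : MonotoneOn e (Ici a)) {b t : ℝ}
    (hab : a ≤ b) (hbt : b ≤ t) (hnonneg : ∀ t, a ≤ t → 0 ≤ e t) :
    e b * (t - b) ≤ energy e a t := by
  have h1 : 0 ≤ ∫ τ in a..b, e τ :=
    intervalIntegral.integral_nonneg hab fun τ hτ => hnonneg τ hτ.1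
  have h2 : ∫ _ in b..t, e b ≤ ∫ τ in b..t, e τ :=
    intervalIntegral.integral_mono_on hbt (by simp) (he.intervalIntegrable _ _)
      fun τ hτ => hmono hab (hab.trans hτ.1) hτ.1
  have h3 : (∫ τ in a..b, e τ) + ∫ τ in b..t, e τ = energy e a t :=
    intervalIntegral.integral_add_adjacent_intervals (he.intervalIntegrable _ _)
      (he.intervalIntegrable _ _)
  rw [intervalIntegral.integral_const, smul_eq_mul] at h2
  linarith

theorem energy_le_mul_sub (he : Continuous e) (hmono : MonotoneOn e (Ici a)) {t : ℝ}
    (hat : a ≤ t) : energy e a t ≤ e t * (t - a) := by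
  have h2 : ∫ τ in a..t, e τ ≤ ∫ _ in a..t, e t :=
    intervalIntegral.integral_mono_on hat (he.intervalIntegrable _ _) (by simp)
      fun τ hτ => hmono hτ.1 hat hτ.2
  rw [intervalIntegral.integral_const, smul_eq_mul] at h2
  unfold energy
  linarith

theorem intervalIntegrable_sub_rpow_neg_half (t : ℝ) :
    IntervalIntegrable (fun τ => (τ - a) ^ (-(1 / 2) : ℝ)) volume a t := by
  have := (intervalIntegral.intervalIntegrable_rpow' (a := 0) (b := t - a)
    (r := -(1 / 2)) (by norm_num)).comp_sub_right a
  simpa using this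

theorem energy_pos (he : Continuous e) (hpos : ∀ t, a ≤ t → 0 < e t)
    (hmono : MonotoneOn e (Ici a)) {t : ℝ} (ht : a < t) : 0 < energy e a t :=
  (mul_pos (hpos a le_rfl) (sub_pos.2 ht)).trans_le
    (mul_sub_le_energy he hmono le_rfl ht.le fun s hs => (hpos s hs).le)

theorem speed_pos (he : Continuous e) (hpos : ∀ t, a ≤ t → 0 < e t)
    (hmono : MonotoneOn e (Ici a)) {t : ℝ} (ht : a < t) : 0 < speed e a t :=
  Real.sqrt_pos.2 (mul_pos two_pos (energy_pos he hpos hmono ht))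

/-- Near the starting height the speed is at least a multiple of `(t - a)^(1/2)`, so leaving rest
costs finite time. -/
theorem intervalIntegrable_inv_speed_left (he : Continuous e) (hpos : ∀ t, a ≤ t → 0 < e t)
    (hmono : MonotoneOn e (Ici a)) {t : ℝ} (ht : a ≤ t) :
    IntervalIntegrable (fun τ => (speed e a τ)⁻¹) volume a t := by
  refine ((intervalIntegrable_sub_rpow_neg_half t).const_mul (√(2 * e a))⁻¹).mono_fun'
    (continuous_speed he).measurable.inv.aestronglyMeasurable ?_
  rw [uIoc_of_le ht]
  refine (ae_restrict_iff' measurableSet_Ioc).2 (Eventually.of_forall fun τ hτ => ?_)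
  have h0 : 0 < τ - a := sub_pos.2 hτ.1
  have h1 : 0 < 2 * e a := mul_pos two_pos (hpos a le_rfl)
  have h2 : √(2 * e a) * √(τ - a) ≤ speed e a τ := by
    rw [← Real.sqrt_mul h1.le]
    refine Real.sqrt_le_sqrt ?_
    have := mul_sub_le_energy he hmono le_rfl hτ.1.le fun s hs => (hpos s hs).le
    linarith
  beta_reduce
  rw [Real.norm_of_nonneg (inv_nonneg.2 (speed_nonneg τ)), Real.rpow_neg h0.le,
    ← Real.sqrt_eq_rpow, ← mul_inv]
  exact inv_anti₀ (by positivity) h2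

theorem intervalIntegrable_inv_speed (he : Continuous e) (hpos : ∀ t, a ≤ t → 0 < e t)
    (hmono : MonotoneOn e (Ici a)) {s t : ℝ} (hs : a ≤ s) (ht : a ≤ t) :
    IntervalIntegrable (fun τ => (speed e a τ)⁻¹) volume s t :=
  (intervalIntegrable_inv_speed_left he hpos hmono hs).symm.trans
    (intervalIntegrable_inv_speed_left he hpos hmono ht)

theorem travelTime_self : travelTime e a a = 0 := by simp [travelTime]

theorem strictMonoOn_travelTime (he : Continuous e) (hpos : ∀ t, a ≤ t → 0 < e t)
    (hmono : MonotoneOn e (Ici a)) : StrictMonoOn (travelTime e a) (Ici a) := by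
  intro s hs t ht hst
  have h := intervalIntegral.intervalIntegral_pos_of_pos_on
    (intervalIntegrable_inv_speed he hpos hmono hs ht)
    (fun τ hτ => inv_pos.2 (speed_pos he hpos hmono (lt_of_le_of_lt hs hτ.1))) hst
  have h3 : travelTime e a s + _ = travelTime e a t :=
    intervalIntegral.integral_add_adjacent_intervals
      (intervalIntegrable_inv_speed_left he hpos hmono hs)
      (intervalIntegrable_inv_speed he hpos hmono hs ht)
  linarith

theorem hasDerivAt_travelTime (he : Continuous e) (hpos : ∀ t, a ≤ t → 0 < e t)
    (hmono : MonotoneOn e (Ici a)) {t : ℝ} (ht : a < t) :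
    HasDerivAt (travelTime e a) (speed e a t)⁻¹ t :=
  intervalIntegral.integral_hasDerivAt_right
    (intervalIntegrable_inv_speed_left he hpos hmono ht.le)
    ((continuous_speed he).measurable.inv.stronglyMeasurable.stronglyMeasurableAtFilter)
    ((continuous_speed he).continuousAt.inv₀ (speed_pos he hpos hmono ht).ne')

theorem continuousOn_travelTime (he : Continuous e) (hpos : ∀ t, a ≤ t → 0 < e t)
    (hmono : MonotoneOn e (Ici a)) (b : ℝ) : ContinuousOn (travelTime e a) (Icc a b) := by
  rcases le_total a b with hab | hab
  · have := intervalIntegral.continuousOn_primitive_interval'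
      (intervalIntegrable_inv_speed_left he hpos hmono hab) left_mem_uIcc
    rwa [uIcc_of_le hab] at this
  · exact (continuousOn_singleton (travelTime e a) a).mono fun x hx =>
      le_antisymm (hx.2.trans hab) hx.1

theorem isOpen_lifespan : IsOpen (lifespan e a) := by
  have : lifespan e a = ⋃ t ∈ Ici a, {s | |s| < travelTime e a t} := by
    ext s; simp [lifespan]
  rw [this]
  exact isOpen_biUnion fun t _ => isOpen_lt continuous_abs continuous_const

theorem neg_mem_lifespan {s : ℝ} (hs : s ∈ lifespan e a) : -s ∈ lifespan e a := by
  simpa [lifespan] using hs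

theorem profile_neg (s : ℝ) : profile e a (-s) = profile e a s := by simp [profile]

theorem profileDeriv_neg (s : ℝ) : profileDeriv e a (-s) = -profileDeriv e a s := by
  simp [profileDeriv, profile_neg, Left.sign_neg]

/-- Intermediate value theorem. Outside `lifespan` the inverse in `profile` may be a junk value,
hence the membership hypotheses below. -/
theorem abs_mem_image_travelTime (he : Continuous e) (hpos : ∀ t, a ≤ t → 0 < e t)
    (hmono : MonotoneOn e (Ici a)) {s : ℝ} (hs : s ∈ lifespan e a) :
    |s| ∈ travelTime e a '' Ici a := by
  obtain ⟨t, hat, hst⟩ := hs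
  have := intermediate_value_Icc hat (continuousOn_travelTime he hpos hmono t)
    (show |s| ∈ Icc _ _ from ⟨by rw [travelTime_self]; exact abs_nonneg s, hst.le⟩)
  exact image_mono Icc_subset_Ici_self this

theorem le_profile (he : Continuous e) (hpos : ∀ t, a ≤ t → 0 < e t)
    (hmono : MonotoneOn e (Ici a)) {s : ℝ} (hs : s ∈ lifespan e a) : a ≤ profile e a s :=
  Function.invFunOn_mem (abs_mem_image_travelTime he hpos hmono hs)

theorem travelTime_profile (he : Continuous e) (hpos : ∀ t, a ≤ t → 0 < e t)
    (hmono : MonotoneOn e (Ici a)) {s : ℝ} (hs : s ∈ lifespan e a) :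
    travelTime e a (profile e a s) = |s| :=
  Function.invFunOn_eq (abs_mem_image_travelTime he hpos hmono hs)

theorem profile_lt_iff (he : Continuous e) (hpos : ∀ t, a ≤ t → 0 < e t)
    (hmono : MonotoneOn e (Ici a)) {s b : ℝ} (hs : s ∈ lifespan e a) (hb : a ≤ b) :
    profile e a s < b ↔ |s| < travelTime e a b := by
  rw [← travelTime_profile he hpos hmono hs]
  exact ((strictMonoOn_travelTime he hpos hmono).lt_iff_lt (le_profile he hpos hmono hs) hb).symm

theorem lt_profile_iff (he : Continuous e) (hpos : ∀ t, a ≤ t → 0 < e t)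
    (hmono : MonotoneOn e (Ici a)) {s b : ℝ} (hs : s ∈ lifespan e a) (hb : a ≤ b) :
    b < profile e a s ↔ travelTime e a b < |s| := by
  rw [← travelTime_profile he hpos hmono hs]
  exact ((strictMonoOn_travelTime he hpos hmono).lt_iff_lt hb (le_profile he hpos hmono hs)).symm

theorem profile_le_profile (he : Continuous e) (hpos : ∀ t, a ≤ t → 0 < e t)
    (hmono : MonotoneOn e (Ici a)) {s t : ℝ} (hs : s ∈ lifespan e a) (ht : t ∈ lifespan e a)
    (hst : |s| ≤ |t|) : profile e a s ≤ profile e a t := by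
  by_contra! h
  rw [lt_profile_iff he hpos hmono hs (le_profile he hpos hmono ht),
    travelTime_profile he hpos hmono ht] at h
  exact h.not_ge hst

theorem profile_zero (he : Continuous e) (hpos : ∀ t, a ≤ t → 0 < e t)
    (hmono : MonotoneOn e (Ici a)) : profile e a 0 = a := by
  have h0 : (0 : ℝ) ∈ lifespan e a := ⟨a + 1, by linarith, by
    rw [abs_zero, ← travelTime_self (e := e) (a := a)]
    exact strictMonoOn_travelTime he hpos hmono self_mem_Ici (by simp) (by linarith)⟩
  refine (strictMonoOn_travelTime he hpos hmono).injOn (le_profile he hpos hmono h0)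
    self_mem_Ici ?_
  rw [travelTime_profile he hpos hmono h0, travelTime_self, abs_zero]

theorem continuousAt_profile (he : Continuous e) (hpos : ∀ t, a ≤ t → 0 < e t)
    (hmono : MonotoneOn e (Ici a)) {s : ℝ} (hs : s ∈ lifespan e a) :
    ContinuousAt (profile e a) s := by
  have hev : ∀ᶠ y in 𝓝 s, y ∈ lifespan e a := isOpen_lifespan.mem_nhds hs
  refine tendsto_order.2 ⟨fun b hb => ?_, fun b hb => ?_⟩
  · rcases lt_or_ge b a with hba | hab
    · filter_upwards [hev] with y hy using hba.trans_le (le_profile he hpos hmono hy)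
    · rw [lt_profile_iff he hpos hmono hs hab] at hb
      filter_upwards [hev, continuous_abs.continuousAt.eventually_const_lt hb] with y hy hy'
        using (lt_profile_iff he hpos hmono hy hab).2 hy'
  · have hab := (le_profile he hpos hmono hs).trans hb.le
    rw [gt_iff_lt, profile_lt_iff he hpos hmono hs hab] at hb
    filter_upwards [hev, continuous_abs.continuousAt.eventually_lt_const hb] with y hy hy'
      using (profile_lt_iff he hpos hmono hy hab).2 hy'

theorem lt_profile (he : Continuous e) (hpos : ∀ t, a ≤ t → 0 < e t)
    (hmono : MonotoneOn e (Ici a)) {s : ℝ} (hs : s ∈ lifespan e a) (hs0 : s ≠ 0) :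
    a < profile e a s := by
  rw [lt_profile_iff he hpos hmono hs le_rfl, travelTime_self]
  exact abs_pos.2 hs0

/-- Inverse function rule for `travelTime`. It breaks down at time `0`, where the speed vanishes;
there the derivative is recovered by continuity. -/
theorem hasDerivAt_profile_of_ne (he : Continuous e) (hpos : ∀ t, a ≤ t → 0 < e t)
    (hmono : MonotoneOn e (Ici a)) {s : ℝ} (hs : s ∈ lifespan e a) (hs0 : s ≠ 0) :
    HasDerivAt (profile e a) (profileDeriv e a s) s := by
  have key : ∀ s ∈ lifespan e a, 0 < s → HasDerivAt (profile e a) (profileDeriv e a s) s := by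
    intro s hs h0
    have hlt := lt_profile he hpos hmono hs h0.ne'
    have h := HasDerivAt.of_local_left_inverse (continuousAt_profile he hpos hmono hs)
      (hasDerivAt_travelTime he hpos hmono hlt)
      (inv_ne_zero (speed_pos he hpos hmono hlt).ne') (by
        filter_upwards [isOpen_lifespan.mem_nhds hs, lt_mem_nhds h0] with y hy hy0
        rw [travelTime_profile he hpos hmono hy, abs_of_pos hy0])
    simpa [profileDeriv, sign_pos h0] using h
  rcases hs0.lt_or_gt with h0 | h0
  · have h := (key (-s) (neg_mem_lifespan hs) (by linarith)).scomp s (hasDerivAt_neg s)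
    simpa [profileDeriv_neg, Function.comp_def, profile_neg] using h
  · exact key s hs h0

theorem continuousAt_profileDeriv_zero (he : Continuous e) (hpos : ∀ t, a ≤ t → 0 < e t)
    (hmono : MonotoneOn e (Ici a)) (hs : (0 : ℝ) ∈ lifespan e a) :
    ContinuousAt (profileDeriv e a) 0 := by
  have h1 : Tendsto (fun s => speed e a (profile e a s)) (𝓝 0) (𝓝 0) := by
    have := ((continuous_speed he (a := a)).continuousAt.comp
      (continuousAt_profile he hpos hmono hs)).tendsto
    simpa [Function.comp_def, profile_zero he hpos hmono, speed_self] using this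
  have h2 : profileDeriv e a 0 = 0 := by simp [profileDeriv]
  rw [ContinuousAt, h2]
  refine squeeze_zero_norm (fun s => ?_) h1
  rcases lt_trichotomy s 0 with h | h | h <;>
    simp [profileDeriv, h, abs_of_nonneg, speed_nonneg]

theorem hasDerivAt_profile (he : Continuous e) (hpos : ∀ t, a ≤ t → 0 < e t)
    (hmono : MonotoneOn e (Ici a)) {s : ℝ} (hs : s ∈ lifespan e a) :
    HasDerivAt (profile e a) (profileDeriv e a s) s := by
  rcases eq_or_ne s 0 with rfl | hs0
  · refine hasDerivAt_of_eventually_hasDerivAt ?_ (continuousAt_profile he hpos hmono hs)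
      (continuousAt_profileDeriv_zero he hpos hmono hs)
    filter_upwards [isOpen_lifespan.mem_nhds hs] with y hy hy0
      using hasDerivAt_profile_of_ne he hpos hmono hy hy0
  · exact hasDerivAt_profile_of_ne he hpos hmono hs hs0

/-- Differentiating `V' = √(2E(V))` gives `(e(V)/V') * V' = e(V)`. -/
theorem hasDerivAt_profileDeriv_of_ne (he : Continuous e) (hpos : ∀ t, a ≤ t → 0 < e t)
    (hmono : MonotoneOn e (Ici a)) {s : ℝ} (hs : s ∈ lifespan e a) (hs0 : s ≠ 0) :
    HasDerivAt (profileDeriv e a) (e (profile e a s)) s := by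
  have key : ∀ s ∈ lifespan e a, 0 < s → HasDerivAt (profileDeriv e a) (e (profile e a s)) s := by
    intro s hs h0
    have hlt := lt_profile he hpos hmono hs h0.ne'
    have h1 : HasDerivAt (speed e a) (2 * e (profile e a s) / (2 * speed e a (profile e a s)))
        (profile e a s) :=
      ((hasDerivAt_energy he _).const_mul 2).sqrt
        (mul_pos two_pos (energy_pos he hpos hmono hlt)).ne'
    have h2 := h1.comp s (hasDerivAt_profile he hpos hmono hs)
    have h3 := speed_pos he hpos hmono hlt
    have h4 : 2 * e (profile e a s) / (2 * speed e a (profile e a s)) * profileDeriv e a s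
        = e (profile e a s) := by
      simp only [profileDeriv, sign_pos h0]
      simp
      field_simp
    rw [h4] at h2
    refine h2.congr_of_eventuallyEq ?_
    filter_upwards [lt_mem_nhds h0] with y hy
    simp [profileDeriv, sign_pos hy]
  rcases hs0.lt_or_gt with h0 | h0
  · have h := ((key (-s) (neg_mem_lifespan hs) (by linarith)).scomp s (hasDerivAt_neg s)).neg
    simpa [profileDeriv_neg, Function.comp_def, profile_neg, Pi.neg_def] using h
  · exact key s hs h0

theorem hasDerivAt_profileDeriv (he : Continuous e) (hpos : ∀ t, a ≤ t → 0 < e t)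
    (hmono : MonotoneOn e (Ici a)) {s : ℝ} (hs : s ∈ lifespan e a) :
    HasDerivAt (profileDeriv e a) (e (profile e a s)) s := by
  rcases eq_or_ne s 0 with rfl | hs0
  · refine hasDerivAt_of_eventually_hasDerivAt (f' := fun s => e (profile e a s)) ?_
      (continuousAt_profileDeriv_zero he hpos hmono hs)
      (he.continuousAt.comp (continuousAt_profile he hpos hmono hs))
    filter_upwards [isOpen_lifespan.mem_nhds hs] with y hy hy0
      using hasDerivAt_profileDeriv_of_ne he hpos hmono hy hy0
  · exact hasDerivAt_profileDeriv_of_ne he hpos hmono hs hs0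

end Energy

/-! ### Comparison with radial barriers. -/

/-- A second-order Taylor upper bound. -/
theorem eventually_le_quadratic {V V' : ℝ → ℝ} {s d c : ℝ}
    (hV : ∀ᶠ y in 𝓝 s, HasDerivAt V (V' y) y) (hV' : HasDerivAt V' d s) (hc : d < c) :
    ∀ᶠ y in 𝓝 s, V y ≤ V s + V' s * (y - s) + c / 2 * (y - s) ^ 2 := by
  -- The gap `w` has zero value and slope at `s` and second derivative `c - d > 0` there, so `s` is
  -- a local minimum.
  set w : ℝ → ℝ := fun y => V s + V' s * (y - s) + c / 2 * (y - s) ^ 2 - V y with hw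
  have h1 : ∀ᶠ y in 𝓝 s, HasDerivAt w (V' s + c * (y - s) - V' y) y := by
    filter_upwards [hV] with y hy
    have hy1 : HasDerivAt (fun y => y - s) 1 y := (hasDerivAt_id y).sub_const s
    convert! (((hy1.const_mul (V' s)).const_add (V s)).add
      ((hy1.pow 2).const_mul (c / 2))).sub hy using 1
    ring
  have h2 : HasDerivAt (fun y => V' s + c * (y - s) - V' y) (c - d) s := by
    have hy1 : HasDerivAt (fun y => y - s) 1 s := (hasDerivAt_id s).sub_const s
    simpa using! ((hy1.const_mul c).const_add (V' s)).sub hV'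
  have h3 : deriv w =ᶠ[𝓝 s] fun y => V' s + c * (y - s) - V' y := h1.mono fun y hy => hy.deriv
  have hmin : IsLocalMin w s := by
    refine isLocalMin_of_deriv_deriv_pos ?_ ?_ h1.self_of_nhds.continuousAt
    · rw [h3.deriv_eq, h2.deriv]
      linarith
    · rw [h3.self_of_nhds]
      ring
  filter_upwards [hmin] with y hy
  simp only [hw] at hy
  ring_nf at hy ⊢
  linarith

theorem UpperSemicontinuous.exists_isMaxOn_closedBall_sub {n : ℕ} {u : Rn n → ℝ}
    (hu : UpperSemicontinuous u) {w : Rn n → ℝ} {x₀ : Rn n} {ρ : ℝ} (hρ : 0 ≤ ρ)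
    (hw : ContinuousOn w (Metric.closedBall x₀ ρ)) :
    ∃ x ∈ Metric.closedBall x₀ ρ, IsMaxOn (fun y => u y - w y) (Metric.closedBall x₀ ρ) x := by
  refine UpperSemicontinuousOn.exists_isMaxOn ⟨x₀, Metric.mem_closedBall_self hρ⟩
    (isCompact_closedBall x₀ ρ) ?_
  simp only [sub_eq_add_neg]
  exact (hu.upperSemicontinuousOn _).add hw.neg.upperSemicontinuousOn

section Nonexistence

variable {n k : ℕ} {f g : ℝ → ℝ} {q : ℝ} {u : Rn n → ℝ}

/-- Entire subsolutions are unbounded above. -/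
theorem IsEntireViscositySubsolution.exists_lt (hu : IsEntireViscositySubsolution k f g q u)
    (hfpos : ∀ t, 0 < f t) (hfmono : StrictMono f) (hgnonneg : ∀ t, 0 ≤ g t) (b : ℝ) :
    ∃ x, b < u x := by
  by_contra! hb
  set m := f (u 0)
  have hm : 0 < m := hfpos _
  -- The paraboloid `η|x|²` has Hessian `2η` times the identity; this `η` makes `2kη < m`,
  -- contradicting the equation at an interior maximum.
  set η := m / (4 * (k + 1)) with hη_def
  have hη : 0 < η := by positivity
  -- On the sphere of radius `ρ` the penalty exceeds `b - u 0`, which keeps the maximum in the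
  -- interior.
  set ρ := √((b - u 0 + 1) / η) with hρ_def
  have hb0 : 0 ≤ b - u 0 := sub_nonneg.2 (hb 0)
  have hρsq : η * ρ ^ 2 = b - u 0 + 1 := by
    rw [hρ_def, Real.sq_sqrt (by positivity)]
    field_simp
  obtain ⟨x, hx, hmax⟩ := hu.1.exists_isMaxOn_closedBall_sub (x₀ := 0) (ρ := ρ)
    (Real.sqrt_nonneg _) (w := radialQuartic 0 η 0 0) 
    (contDiff_radialQuartic _ _ _ _).continuous.continuousOn
  have hrad : ∀ s (y : Rn n), radialQuartic 0 η 0 s y = η * ‖y‖ ^ 2 := by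
    intro s y; simp [radialQuartic]
  have h0 : u 0 ≤ u x - η * ‖x‖ ^ 2 := by
    have := hmax (Metric.mem_closedBall_self (Real.sqrt_nonneg _))
    simpa [hrad] using this
  have hlt : ‖x‖ < ρ := by
    by_contra! hge
    have h1 : η * ρ ^ 2 ≤ η * ‖x‖ ^ 2 := by gcongr
    linarith [hb x]
  have hloc : IsLocalMax (fun y => u y - radialQuartic 0 η 0 (‖x - 0‖ ^ 2) y) x := by
    have := hmax.isLocalMax (Metric.closedBall_mem_nhds_of_mem (by simpa using hlt))
    simpa only [hrad] using this
  have h := hu.le_of_radialQuartic hη.le le_rfl hloc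
  have h2 : m ≤ f (u x) := hfmono.monotone (h0.trans (by linarith [show 0 ≤ η * ‖x‖ ^ 2 by positivity]))
  have h3 : 0 ≤ g (u x) * (2 * η * ‖x - 0‖) ^ q := mul_nonneg (hgnonneg _) (by positivity)
  have h4 : (k : ℝ) * (2 * η) < m := by
    rw [hη_def, show (k : ℝ) * (2 * (m / (4 * (k + 1)))) = m * (2 * k / (4 * (k + 1))) by ring]
    refine mul_lt_of_lt_one_right hm ?_
    rw [div_lt_one (by positivity)]
    linarith [(Nat.cast_nonneg k : (0 : ℝ) ≤ k)]
  linarith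

/-- Comparison with a radial barrier that blows up in finite time. -/
theorem IsEntireViscositySubsolution.le_of_travelTime_bounded
    (hu : IsEntireViscositySubsolution k f g q u) (hq0 : 0 < q)
    (hfmono : StrictMono f) (hgmono : Monotone g)
    {e : ℝ → ℝ} {a R : ℝ} (he : Continuous e) (hpos : ∀ t, a ≤ t → 0 < e t)
    (hmono : MonotoneOn e (Ici a))
    (hle : ∀ t, a ≤ t → (k + 1) * e t ≤ f t + g t * speed e a t ^ q)
    (hR : ∀ t, a ≤ t → travelTime e a t ≤ R) (x₀ : Rn n) : u x₀ ≤ a := by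
  by_contra! hlt
  set V := profile e a
  obtain ⟨M, hM⟩ := UpperSemicontinuousOn.bddAbove_of_isCompact (isCompact_closedBall x₀ R)
    (hu.1.upperSemicontinuousOn _)
  -- The barrier reaches `t₁ > M` at radius `ρ ≤ R`, where it exceeds `u`; as `u x₀ > a`, the
  -- maximum of `u - V` is interior and positive.
  set t₁ := max a M + 1
  have hat₁ : a < t₁ := (le_max_left a M).trans_lt (lt_add_one _)
  have hMt₁ : M < t₁ := (le_max_right a M).trans_lt (lt_add_one _)
  set ρ := travelTime e a t₁
  have hρ0 : 0 < ρ := by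
    simpa only [travelTime_self] using strictMonoOn_travelTime he hpos hmono self_mem_Ici hat₁.le hat₁
  have hlife : ∀ s, |s| ≤ ρ → s ∈ lifespan e a := fun s hs => ⟨t₁ + 1, by linarith, hs.trans_lt
    (strictMonoOn_travelTime he hpos hmono hat₁.le (by simp; linarith) (lt_add_one _))⟩
  have hcont : ContinuousOn (fun x : Rn n => V ‖x - x₀‖) (Metric.closedBall x₀ ρ) := by
    intro x hx
    refine ContinuousAt.continuousWithinAt ?_
    refine ContinuousAt.comp (f := fun x : Rn n => ‖x - x₀‖) (g := V) (continuousAt_profile he hpos hmono (hlife _ ?_)) (by fun_prop)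
    rw [abs_norm]
    exact mem_closedBall_iff_norm.1 hx
  obtain ⟨x, hx, hmax⟩ := hu.1.exists_isMaxOn_closedBall_sub hρ0.le hcont
  set r := ‖x - x₀‖ with hr
  have hr0 : 0 ≤ r := norm_nonneg _
  have hrρ : r ≤ ρ := mem_closedBall_iff_norm.1 hx
  have habs : |r| = r := abs_of_nonneg hr0
  have hrl : r ∈ lifespan e a := hlife r (by rwa [habs])
  have haV : a ≤ V r := le_profile he hpos hmono hrl
  have hux : u x₀ - a ≤ u x - V r := by
    have := hmax (Metric.mem_closedBall_self hρ0.le)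
    simpa [V, profile_zero he hpos hmono] using this
  have huM : u x ≤ M :=
    hM ⟨x, Metric.closedBall_subset_closedBall (hR t₁ hat₁.le) hx, rfl⟩
  have hrlt : r < ρ := by
    have h1 := (profile_lt_iff he hpos hmono hrl hat₁.le).1 (by change V r < t₁; linarith)
    rwa [habs] at h1
  have hball : Metric.closedBall x₀ ρ ∈ 𝓝 x :=
    Metric.closedBall_mem_nhds_of_mem (mem_ball_iff_norm.2 hrlt)
  have hspeed : profileDeriv e a r = speed e a (V r) := by
    rcases hr0.eq_or_lt with h | h
    · simp [← h, profileDeriv, V, profile_zero he hpos hmono, speed_self]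
    · simp [profileDeriv, sign_pos h, V]
  -- The Taylor bound needs `c` strictly above `V''`; the limit `c → e (V r)` is taken in `hlim`.
  have htest : ∀ c, e (V r) < c →
      f (u x) + g (u x) * speed e a (V r) ^ q ≤ (k + 1) * c := by
    intro c hc
    have hc0 : 0 < c := (hpos _ haV).trans hc
    have hquad := eventually_le_quadratic
      ((isOpen_lifespan.eventually_mem hrl).mono fun y hy => hasDerivAt_profile he hpos hmono hy)
      (hasDerivAt_profileDeriv he hpos hmono hrl) hc
    rcases hr0.eq_or_lt with h0 | h0
    · have hV0 : V r = a := by rw [← h0]; exact profile_zero he hpos hmono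
      have hloc : IsLocalMax (fun y => u y - radialQuartic x₀ (c / 2) 0 (‖x - x₀‖ ^ 2) y) x := by
        have ht : Tendsto (fun y : Rn n => ‖y - x₀‖) (𝓝 x) (𝓝 r) := by
          rw [hr]; exact (Continuous.norm (by fun_prop)).continuousAt
        filter_upwards [hball, ht.eventually hquad] with y hy hy'
        have h1 := hmax hy
        simp only [Set.mem_ofPred_eq] at h1
        rw [hspeed, ← h0] at hy'
        simp only [profileDeriv, V] at *
        simp [radialQuartic, ← hr, ← h0] at *
        rw [hV0, speed_self] at hy'
        linarith
      have h := hu.le_of_radialQuartic (by positivity) le_rfl hloc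
      rw [← hr, ← h0] at h
      rw [hV0, speed_self]
      simp only [mul_zero, Real.zero_rpow hq0.ne', add_zero] at h ⊢
      linarith
    -- Up to a constant, this quartic is the Taylor bound of `V` evaluated at `r + (|y - x₀|² -
    -- r²)/(2r)`, a smooth majorant of `|y - x₀|` touching it at `x`.
    · have hloc : IsLocalMax (fun y => u y -
          radialQuartic x₀ (speed e a (V r) / (2 * r)) (c / (8 * r ^ 2)) (‖x - x₀‖ ^ 2) y) x := by
        have ht : Tendsto (fun y : Rn n => r + (‖y - x₀‖ ^ 2 - r ^ 2) / (2 * r)) (𝓝 x) (𝓝 r) := by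
          have : ContinuousAt (fun y : Rn n => r + (‖y - x₀‖ ^ 2 - r ^ 2) / (2 * r)) x := by
            fun_prop
          simpa [ContinuousAt, ← hr] using this
        filter_upwards [hball, ht.eventually hquad, ht.eventually (isOpen_lifespan.eventually_mem hrl)] with y hy hy' hyl
        have h1 := hmax hy
        simp only [Set.mem_ofPred_eq] at h1
        have h2 : ‖y - x₀‖ ≤ r + (‖y - x₀‖ ^ 2 - r ^ 2) / (2 * r) := by
          have : r + (‖y - x₀‖ ^ 2 - r ^ 2) / (2 * r) - ‖y - x₀‖ = (‖y - x₀‖ - r) ^ 2 / (2 * r) := by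
            field_simp; ring
          have : 0 ≤ (‖y - x₀‖ - r) ^ 2 / (2 * r) := by positivity
          linarith
        have h3 : V ‖y - x₀‖ ≤ V (r + (‖y - x₀‖ ^ 2 - r ^ 2) / (2 * r)) := by
          refine profile_le_profile he hpos hmono (hlife _ ?_) hyl ?_
          · rw [abs_norm]; exact mem_closedBall_iff_norm.1 hy
          · rw [abs_norm]; exact h2.trans (le_abs_self _)
        rw [hspeed] at hy'
        have h4 : radialQuartic x₀ (speed e a (V r) / (2 * r)) (c / (8 * r ^ 2)) (‖x - x₀‖ ^ 2) y
            - radialQuartic x₀ (speed e a (V r) / (2 * r)) (c / (8 * r ^ 2)) (‖x - x₀‖ ^ 2) x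
            = speed e a (V r) * (r + (‖y - x₀‖ ^ 2 - r ^ 2) / (2 * r) - r)
              + c / 2 * (r + (‖y - x₀‖ ^ 2 - r ^ 2) / (2 * r) - r) ^ 2 := by
          simp only [radialQuartic, ← hr]
          field_simp
          ring
        linarith
      have h := hu.le_of_radialQuartic (div_nonneg (speed_nonneg _) (by positivity)) (by positivity) hloc
      rw [← hr] at h
      have h5 : 2 * (speed e a (V r) / (2 * r)) * r = speed e a (V r) := by field_simp
      have h6 : 8 * (c / (8 * r ^ 2)) * r ^ 2 = c := by field_simp
      rw [h5, h6] at h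
      -- The tangential eigenvalue `V'/r` is, by the mean value theorem, `V''` at an earlier time,
      -- and `V'' = e(V)` is nondecreasing.
      have h7 : 2 * (speed e a (V r) / (2 * r)) ≤ e (V r) := by
        obtain ⟨ξ, hξ, hξe⟩ := exists_hasDerivAt_eq_slope (profileDeriv e a) (fun s => e (V s)) h0
          (fun s hs => (hasDerivAt_profileDeriv he hpos hmono
            (hlife s (by rw [abs_of_nonneg hs.1]; linarith [hs.2]))).continuousAt.continuousWithinAt)
          (fun s hs => hasDerivAt_profileDeriv he hpos hmono
            (hlife s (by rw [abs_of_pos hs.1]; linarith [hs.2])))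
        have hξl : ξ ∈ lifespan e a := hlife ξ (by rw [abs_of_pos hξ.1]; linarith [hξ.2])
        have h8 : e (V ξ) ≤ e (V r) := hmono (le_profile he hpos hmono hξl) haV
          (profile_le_profile he hpos hmono hξl hrl
            (by rw [habs, abs_of_pos hξ.1]; exact hξ.2.le))
        have h9 : profileDeriv e a 0 = 0 := by simp [profileDeriv]
        rw [hspeed, h9, sub_zero, sub_zero] at hξe
        calc 2 * (speed e a (V r) / (2 * r)) = speed e a (V r) / r := by field_simp
          _ ≤ e (V r) := by rw [← hξe]; exact h8
      have h10 : (k : ℝ) * (2 * (speed e a (V r) / (2 * r))) ≤ k * c := by gcongr; linarith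
      linarith
  have hlim : f (u x) + g (u x) * speed e a (V r) ^ q ≤ (k + 1) * e (V r) := by
    have hk1 : (0 : ℝ) < k + 1 := by positivity
    rw [← div_le_iff₀' hk1]
    refine le_of_forall_gt_imp_ge_of_dense fun c hc => ?_
    rw [div_le_iff₀' hk1]
    exact htest c hc
  -- Since `u x > V r`, strict monotonicity of `f` contradicts the barrier inequality.
  have h1 : f (V r) < f (u x) := hfmono (by linarith)
  have h2 : g (V r) * speed e a (V r) ^ q ≤ g (u x) * speed e a (V r) ^ q :=
    mul_le_mul_of_nonneg_right (hgmono (by linarith)) (Real.rpow_nonneg (speed_nonneg _) _)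
  linarith [hle _ haV]

end Nonexistence

/-! ### Forces with finite total travel time. -/

theorem exists_travelTime_le {e : ℝ → ℝ} {a b : ℝ} (he : Continuous e)
    (hpos : ∀ t, a ≤ t → 0 < e t) (hmono : MonotoneOn e (Ici a)) (hab : a ≤ b)
    (hint : IntegrableOn (fun t => (speed e a t)⁻¹) (Ioi b)) :
    ∃ R, ∀ t, a ≤ t → travelTime e a t ≤ R := by
  have h1 : IntegrableOn (fun t => (speed e a t)⁻¹) (Ioi a) := by
    rw [← Ioc_union_Ioi_eq_Ioi hab]
    exact ((intervalIntegrable_inv_speed_left he hpos hmono hab).1).union hint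
  refine ⟨∫ t in Ioi a, (speed e a t)⁻¹, fun t hat => ?_⟩
  rw [travelTime, intervalIntegral.integral_of_le hat]
  exact setIntegral_mono_set h1 (Eventually.of_forall fun τ => inv_nonneg.2 (speed_nonneg τ))
    Ioc_subset_Ioi_self.eventuallyLE

theorem speed_rpow {e : ℝ → ℝ} {a t : ℝ} (h : 0 ≤ energy e a t) (q : ℝ) :
    speed e a t ^ q = (2 * energy e a t) ^ (q / 2) := by
  rw [speed, Real.sqrt_eq_rpow, ← Real.rpow_mul (by positivity)]
  congr 1
  ring

/-- The force is the derivative of the desired energy `ε(F + G^p)`, where `F`, `G` are primitives of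
`f`, `g` and `p = 2/(2-q)`. Then `speed^q ≥ (ε G^p)^(q/2)`, a multiple of `G^(p-1)`, which is the
power appearing in the force. -/
theorem exists_force_energy_eq (k : ℕ) {q : ℝ} (hq0 : 0 < q) (hq2 : q < 2) {f g : ℝ → ℝ}
    (hf : Continuous f) (hg : Continuous g) (hfpos : ∀ t, 0 < f t) (hfmono : Monotone f)
    (hgnonneg : ∀ t, 0 ≤ g t) (hgmono : Monotone g) (a : ℝ) :
    ∃ (e : ℝ → ℝ) (ε : ℝ), 0 < ε ∧ Continuous e ∧ (∀ t, a ≤ t → 0 < e t) ∧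
      MonotoneOn e (Ici a) ∧
      (∀ t, a ≤ t → (k + 1) * e t ≤ f t + g t * speed e a t ^ q) ∧
      ∀ t, a ≤ t → energy e a t = ε * (energy f a t + energy g a t ^ (2 / (2 - q))) := by
  set p := 2 / (2 - q) with hp
  have h2q : 0 < 2 - q := sub_pos.2 hq2
  have hp1 : 1 ≤ p := by rw [hp, le_div_iff₀ h2q]; linarith
  have hpq : p * (q / 2) = p - 1 := by rw [hp]; field_simp; ring
  set K : ℝ := (k + 1) * p with hK
  have hk1 : (1 : ℝ) ≤ k + 1 := by linarith [(Nat.cast_nonneg k : (0 : ℝ) ≤ k)]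
  have hK1 : 1 ≤ K := one_le_mul_of_one_le_of_one_le hk1 hp1
  have hK0 : 0 < K := by linarith
  -- Solves `K * ε = ε^(q/2)`, using `p * (q/2) = p - 1`, so that the `g` terms match exactly.
  set ε := K ^ (-p) with hε
  have hε0 : 0 < ε := Real.rpow_pos_of_pos hK0 _
  have hεK : K * ε = ε ^ (q / 2) := by
    rw [hε, ← Real.rpow_mul hK0.le, ← Real.rpow_one_add' hK0.le]
    · congr 1; linarith
    · intro h
      have : p * (q / 2) = 0 := by linarith
      have : 0 < p * (q / 2) := by positivity
      linarith
  have hεK1 : (k + 1) * ε ≤ 1 := by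
    have h1 : K * ε ≤ 1 := by
      rw [hεK, hε, ← Real.rpow_mul hK0.le]
      exact Real.rpow_le_one_of_one_le_of_nonpos hK1 (by nlinarith)
    have : (k + 1) * ε ≤ K * ε := by
      rw [hK]; gcongr; exact le_mul_of_one_le_right (by linarith) hp1
    linarith
  set G := energy g a with hG
  set F := energy f a with hF
  have hGnonneg : ∀ t, a ≤ t → 0 ≤ G t := fun t ht =>
    intervalIntegral.integral_nonneg ht fun τ _ => hgnonneg τ
  have hFnonneg : ∀ t, a ≤ t → 0 ≤ F t := fun t ht =>
    intervalIntegral.integral_nonneg ht fun τ _ => (hfpos τ).le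
  have hGmono : MonotoneOn G (Ici a) := by
    intro s hs t ht hst
    have h1 : G s + ∫ τ in s..t, g τ = G t :=
      intervalIntegral.integral_add_adjacent_intervals (hg.intervalIntegrable _ _)
        (hg.intervalIntegrable _ _)
    have h2 : 0 ≤ ∫ τ in s..t, g τ := intervalIntegral.integral_nonneg hst fun τ _ => hgnonneg τ
    linarith
  set e : ℝ → ℝ := fun t => ε * (f t + g t * p * G t ^ (p - 1)) with he_def
  have he : Continuous e := by
    have : Continuous fun t => G t ^ (p - 1) :=
      (continuous_energy hg).rpow_const fun t => Or.inr (by linarith)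
    fun_prop
  have henergy : ∀ t, energy e a t = ε * (F t + G t ^ p) := by
    intro t
    have hd : ∀ s, HasDerivAt (fun s => ε * (F s + G s ^ p)) (e s) s := fun s =>
      (((hasDerivAt_energy hf s).add ((hasDerivAt_energy hg s).rpow_const (Or.inr hp1))).const_mul ε)
    have := intervalIntegral.integral_eq_sub_of_hasDerivAt (fun s _ => hd s)
      (he.intervalIntegrable a t)
    rw [energy, this]
    simp [hF, hG, energy_self, Real.zero_rpow (by linarith : p ≠ 0)]
  refine ⟨e, ε, hε0, he, fun t ht => ?_, fun s hs t ht hst => ?_, fun t ht => ?_,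
    fun t _ => henergy t⟩
  · have := hgnonneg t
    have := hfpos t
    have := hGnonneg t ht
    positivity
  · have h1 := hfmono hst
    have h2 := hgmono hst
    have h3 := hGmono hs ht hst
    have h4 := hGnonneg s hs
    have h5 := hgnonneg s
    have h6 := hgnonneg t
    have h7 : G s ^ (p - 1) ≤ G t ^ (p - 1) := Real.rpow_le_rpow h4 h3 (by linarith)
    simp only [he_def]
    gcongr
  · have hG0 := hGnonneg t ht
    have hF0 := hFnonneg t ht
    have hE : ε * G t ^ p ≤ 2 * energy e a t := by
      rw [henergy]
      have : 0 ≤ ε * G t ^ p := by positivity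
      have : 0 ≤ ε * F t := by positivity
      linarith
    have h1 : ε ^ (q / 2) * G t ^ (p - 1) ≤ speed e a t ^ q := by
      rw [speed_rpow (by rw [henergy]; positivity), ← hpq, Real.rpow_mul hG0,
        ← Real.mul_rpow hε0.le (by positivity)]
      exact Real.rpow_le_rpow (by positivity) hE (by positivity)
    have h2 : g t * (K * ε * G t ^ (p - 1)) ≤ g t * speed e a t ^ q := by
      rw [hεK]
      exact mul_le_mul_of_nonneg_left h1 (hgnonneg t)
    have h3 : (k + 1) * ε * f t ≤ 1 * f t := mul_le_mul_of_nonneg_right hεK1 (hfpos t).le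
    calc (k + 1) * e t = (k + 1) * ε * f t + g t * (K * ε * G t ^ (p - 1)) := by
          simp only [he_def, hK]; ring
      _ ≤ _ := by linarith

/-- If the Keller–Osserman integral converges, then there is a barrier that blows up in finite
time. -/
theorem exists_force_travelTime_le (k : ℕ) {q : ℝ} (hq0 : 0 < q) (hq2 : q < 2) {f g : ℝ → ℝ}
    (hf : Continuous f) (hg : Continuous g) (hfpos : ∀ t, 0 < f t) (hfmono : Monotone f)
    (hgnonneg : ∀ t, 0 ≤ g t) (hgmono : Monotone g) {a : ℝ} (ha : 0 < a)
    (hint : IntegrableOn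
      (fun t => 1 / ((t * f t) ^ ((1 : ℝ) / 2) + (t * g t) ^ (1 / (2 - q)))) (Ioi a)) :
    ∃ (e : ℝ → ℝ) (R : ℝ), Continuous e ∧ (∀ t, a ≤ t → 0 < e t) ∧ MonotoneOn e (Ici a) ∧
      (∀ t, a ≤ t → (k + 1) * e t ≤ f t + g t * speed e a t ^ q) ∧
      ∀ t, a ≤ t → travelTime e a t ≤ R := by
  obtain ⟨e, ε, hε, he, hpos, hmono, hle, hE⟩ :=
    exists_force_energy_eq k hq0 hq2 hf hg hfpos hfmono hgnonneg hgmono a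
  have h2q : 0 < 2 - q := sub_pos.2 hq2
  set ψ : ℝ → ℝ := fun t => 1 / ((t * f t) ^ ((1 : ℝ) / 2) + (t * g t) ^ (1 / (2 - q)))
  -- Energies up to height `t` are bounded below using only `[t/2, t]`, whence the rescaling and the
  -- cut at `2 * a`.
  have hψ : IntegrableOn (fun t => ψ (2⁻¹ * t)) (Ioi (2 * a)) := by
    rw [integrableOn_Ioi_comp_mul_left_iff ψ (2 * a) (by norm_num : (0 : ℝ) < 2⁻¹)]
    simpa using hint
  obtain ⟨R, hR⟩ := exists_travelTime_le (b := 2 * a) he hpos hmono (by linarith) (by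
    refine (hψ.const_mul (√ε)⁻¹).mono'
      (continuous_speed he).measurable.inv.aestronglyMeasurable ?_
    refine (ae_restrict_iff' measurableSet_Ioi).2 (Eventually.of_forall fun t ht => ?_)
    have ht : 2 * a < t := ht
    set τ := 2⁻¹ * t with hτ
    have hτa : a ≤ τ := by linarith
    have hτ0 : 0 < τ := by linarith
    have hfτ := hfpos τ
    have hgτ := hgnonneg τ
    have hF : τ * f τ ≤ energy f a t := by
      have := mul_sub_le_energy hf (hfmono.monotoneOn _) hτa (by linarith : τ ≤ t)
        fun s _ => (hfpos s).le
      rwa [show t - τ = τ by rw [hτ]; ring, mul_comm] at this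
    have hG : τ * g τ ≤ energy g a t := by
      have := mul_sub_le_energy hg (hgmono.monotoneOn _) hτa (by linarith : τ ≤ t)
        fun s _ => hgnonneg s
      rwa [show t - τ = τ by rw [hτ]; ring, mul_comm] at this
    set x := (τ * f τ) ^ ((1 : ℝ) / 2)
    set y := (τ * g τ) ^ (1 / (2 - q))
    have hx0 : 0 < x := by positivity
    have hy0 : 0 ≤ y := by positivity
    have hx : x ^ 2 = τ * f τ := by
      rw [← Real.rpow_natCast, ← Real.rpow_mul (by positivity)]; norm_num
    have hy : y ^ 2 = (τ * g τ) ^ (2 / (2 - q)) := by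
      rw [← Real.rpow_natCast, ← Real.rpow_mul (by positivity)]
      congr 1
      push_cast
      ring
    have hxy : x ^ 2 + y ^ 2 ≤ energy f a t + energy g a t ^ (2 / (2 - q)) := by
      rw [hx, hy]
      exact add_le_add hF (Real.rpow_le_rpow (by positivity) hG (by positivity))
    have hs : √ε * (x + y) ≤ speed e a t := by
      refine Real.le_sqrt_of_sq_le ?_
      rw [mul_pow, Real.sq_sqrt hε.le, hE t (by linarith)]
      nlinarith [mul_nonneg hε.le (sq_nonneg (x - y)), mul_le_mul_of_nonneg_left hxy hε.le]
    rw [Real.norm_of_nonneg (inv_nonneg.2 (speed_nonneg t))]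
    calc (speed e a t)⁻¹ ≤ (√ε * (x + y))⁻¹ := inv_anti₀ (by positivity) hs
      _ = (√ε)⁻¹ * ψ τ := by rw [mul_inv, ← one_div (x + y)])
  exact ⟨e, R, he, hpos, hmono, hle, hR⟩

/-! ### Existence from a global motion. -/

section Existence

variable {n k : ℕ} {f g : ℝ → ℝ} {q : ℝ}

/-- The second derivative test along a line, for `V (x i₀) - φ` at a local maximum. -/
theorem deriv_eq_and_le_of_isLocalMax {V V' : ℝ → ℝ} {V'' : ℝ → ℝ}
    (hV : ∀ s, HasDerivAt V (V' s) s) (hV' : ∀ s, HasDerivAt V' (V'' s) s)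
    (i₀ : Fin n) {φ : Rn n → ℝ} {x : Rn n} (hφ : ContDiffAt ℝ 2 φ x)
    (hmax : IsLocalMax (fun y : Rn n => V (y i₀) - φ y) x) (v : Rn n) :
    fderiv ℝ φ x v = V' (x i₀) * v i₀ ∧
      V'' (x i₀) * v i₀ ^ 2 ≤ fderiv ℝ (fderiv ℝ φ) x v v := by
  set l : ℝ → Rn n := fun t => x + t • v with hl
  have hl0 : l 0 = x := by simp [hl]
  have hld : ∀ t, HasDerivAt l v t := fun t => by
    convert! ((hasDerivAt_id t).smul_const v).const_add x using 1
    simp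
  have hli : ∀ t, HasDerivAt (fun t => l t i₀) (v i₀) t := fun t => by
    simpa [hl] using! ((hasDerivAt_id t).mul_const (v i₀)).const_add (x i₀)
  have hlc : Tendsto l (𝓝 0) (𝓝 x) := by simpa [hl0] using (hld 0).continuousAt.tendsto
  have hφd : ∀ᶠ y in 𝓝 x, DifferentiableAt ℝ φ y :=
    (hφ.eventually (by simp)).mono fun y hy => hy.differentiableAt (by simp)
  set w : ℝ → ℝ := fun t => V (l t i₀) - φ (l t) with hw
  set w' : ℝ → ℝ := fun t => V' (l t i₀) * v i₀ - fderiv ℝ φ (l t) v with hw'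
  have hwd : ∀ᶠ t in 𝓝 (0 : ℝ), HasDerivAt w (w' t) t := by
    filter_upwards [hlc.eventually hφd] with t ht
    exact ((hV _).comp t (hli t)).sub (ht.hasFDerivAt.comp_hasDerivAt t (hld t))
  have hφ2 : DifferentiableAt ℝ (fderiv ℝ φ) x :=
    (hφ.fderiv_right (m := 1) (by norm_num)).differentiableAt (by simp)
  have hwd' : HasDerivAt w' (V'' (x i₀) * v i₀ ^ 2 - fderiv ℝ (fderiv ℝ φ) x v v) 0 := by
    have h1 : HasDerivAt (fun t => V' (l t i₀) * v i₀) (V'' (x i₀) * v i₀ * v i₀) 0 := by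
      have := ((hV' (l 0 i₀)).comp 0 (hli 0)).mul_const (v i₀)
      simpa [hl0] using! this
    have h2 : HasDerivAt (fun t => fderiv ℝ φ (l t)) (fderiv ℝ (fderiv ℝ φ) x v) 0 := by
      have h3 : HasFDerivAt (fderiv ℝ φ) (fderiv ℝ (fderiv ℝ φ) x) (l 0) := by
        rw [hl0]; exact hφ2.hasFDerivAt
      exact h3.comp_hasDerivAt 0 (hld 0)
    have h4 := h1.sub (h2.clm_apply (hasDerivAt_const 0 v))
    convert! h4 using 1
    simp
    ring
  have hwmax : IsLocalMax w 0 := by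
    have := hlc.eventually hmax
    filter_upwards [this] with t ht
    simpa [hw, hl0] using ht
  have hw0 : w' 0 = 0 := hwmax.hasDerivAt_eq_zero hwd.self_of_nhds
  refine ⟨by simp only [hw', hl0] at hw0; linarith, ?_⟩
  by_contra! hlt
  have hdw : deriv w =ᶠ[𝓝 0] w' := hwd.mono fun t ht => ht.deriv
  have hdd : deriv (deriv w) 0 = V'' (x i₀) * v i₀ ^ 2 - fderiv ℝ (fderiv ℝ φ) x v v := by
    rw [hdw.deriv_eq, hwd'.deriv]
  have hmin : IsLocalMin w 0 := isLocalMin_of_deriv_deriv_pos (by rw [hdd]; linarith)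
    (by rw [hdw.self_of_nhds, hw0]) hwd.self_of_nhds.continuousAt
  -- A positive second derivative would make `0` a local minimum as well as a maximum, so `w` would
  -- be locally constant.
  have hconst : w =ᶠ[𝓝 0] fun _ => w 0 := by
    filter_upwards [hmin, hwmax] with t h1 h2 using le_antisymm h2 h1
  have h5 : deriv (deriv w) 0 = 0 := by
    rw [hconst.deriv.deriv_eq]
    simp
  linarith

/-- A global profile gives an entire subsolution depending on one coordinate only. -/
theorem exists_isEntireViscositySubsolution (hk : 1 ≤ k) (hn : 0 < n)
    {e : ℝ → ℝ} {a : ℝ} (he : Continuous e) (hpos : ∀ t, a ≤ t → 0 < e t)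
    (hmono : MonotoneOn e (Ici a))
    (hle : ∀ t, a ≤ t → f t + g t * speed e a t ^ q ≤ e t) (hlife : ∀ s, s ∈ lifespan e a)
    (hgnonneg : ∀ t, 0 ≤ g t) (hq0 : 0 < q) :
    ∃ u : Rn n → ℝ, IsEntireViscositySubsolution k f g q u := by
  let i₀ : Fin n := ⟨0, hn⟩
  refine ⟨fun x => profile e a (x i₀), ?_, fun φ x hφ hmax => ?_⟩
  · have h1 : Continuous (profile e a) :=
      continuous_iff_continuousAt.2 fun s => continuousAt_profile he hpos hmono (hlife s)
    have h2 : Continuous fun x : Rn n => profile e a (x i₀) := h1.comp (by fun_prop)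
    exact h2.upperSemicontinuous
  · have hV := le_profile he hpos hmono (hlife (x i₀))
    have key := deriv_eq_and_le_of_isLocalMax (fun s => hasDerivAt_profile he hpos hmono (hlife s))
      (fun s => hasDerivAt_profileDeriv he hpos hmono (hlife s)) i₀ hφ hmax
    have hgrad : ∇ φ x = profileDeriv e a (x i₀) • EuclideanSpace.single i₀ (1 : ℝ) := by
      refine ext_inner_right ℝ fun v => ?_
      rw [gradient, InnerProductSpace.toDual_symm_apply, (key v).1, inner_smul_left,
        EuclideanSpace.inner_single_left]
      simp
    have hnorm : ‖∇ φ x‖ ≤ speed e a (profile e a (x i₀)) := by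
      rw [hgrad, norm_smul, PiLp.norm_single, norm_one, mul_one]
      rcases lt_trichotomy (x i₀) 0 with h | h | h <;>
        simp [profileDeriv, h, abs_of_nonneg, speed_nonneg]
    have hrpow := mul_le_mul_of_nonneg_left
      (Real.rpow_le_rpow (norm_nonneg _) hnorm hq0.le) (hgnonneg (profile e a (x i₀)))
    have hdiag : e (profile e a (x i₀)) ≤ hessian φ x i₀ i₀ := by
      have := (key (EuclideanSpace.single i₀ 1)).2
      simpa [hessian] using this
    -- Touching the convex profile from above forces the Hessian of `φ` to be positive semidefinite.
    have hsum := apply_self_le_sumLargestEigenvalues hk (hessian_isHermitian hφ) (fun i => by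
      rw [eigenvalues_hessian_eq]
      exact (mul_nonneg (hpos _ hV).le (sq_nonneg _)).trans (key _).2) i₀
    linarith [hle _ hV]

end Existence

/-- A force whose motion dominates the equation and whose energy is controlled by
`t f(t) + (t g(t))^(2/(2-q))`. -/
theorem exists_force_le {q : ℝ} (hq0 : 0 < q) (hq2 : q < 2) {f g : ℝ → ℝ}
    (hf : Continuous f) (hg : Continuous g) (hfpos : ∀ t, 0 < f t) (hfmono : Monotone f)
    (hgnonneg : ∀ t, 0 ≤ g t) (hgmono : Monotone g) :
    ∃ e : ℝ → ℝ, Continuous e ∧ (∀ t, 0 ≤ t → 0 < e t) ∧ MonotoneOn e (Ici 0) ∧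
      (∀ t, 0 ≤ t → f t + g t * speed e 0 t ^ q ≤ e t) ∧
      ∀ t, 0 ≤ t → 2 * energy e 0 t ≤ 4 * (t * f t) + (4 * (t * g t)) ^ (2 / (2 - q)) := by
  have h2q : 0 < 2 - q := sub_pos.2 hq2
  set p := 2 / (2 - q) with hp
  have hp0 : 0 < p := by positivity
  have hpq : p * (1 - q / 2) = 1 := by rw [hp]; field_simp
  set Y : ℝ → ℝ := fun t => 4 * (t * f t) + (4 * (t * g t)) ^ p with hY
  set e : ℝ → ℝ := fun t => f t + g t * Y t ^ (q / 2) with he_def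
  have hYc : Continuous Y := by
    have : Continuous fun t => (4 * (t * g t)) ^ p :=
      (by fun_prop : Continuous fun t => 4 * (t * g t)).rpow_const fun t => Or.inr hp0.le
    fun_prop
  have he : Continuous e := by
    have : Continuous fun t => Y t ^ (q / 2) := hYc.rpow_const fun t => Or.inr (by positivity)
    fun_prop
  have hY0 : ∀ t, 0 ≤ t → 0 ≤ Y t := by
    intro t ht
    have := hfpos t
    have := hgnonneg t
    positivity
  have hpos : ∀ t, 0 ≤ t → 0 < e t := by
    intro t ht
    have := hfpos t
    have := hgnonneg t
    have := hY0 t ht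
    positivity
  have hmono : MonotoneOn e (Ici 0) := by
    intro s hs t ht hst
    have hs : 0 ≤ s := hs
    have ht : 0 ≤ t := ht
    have h1 := hfmono hst
    have h2 := hgmono hst
    have h3 := hgnonneg s
    have h4 := hgnonneg t
    have h5 := hfpos s
    have h6 : Y s ≤ Y t := by
      simp only [hY]
      gcongr
    have h7 := hY0 s hs
    simp only [he_def]
    gcongr
  -- The factors `4` in `Y` make each of `t f` and `t g Y^(q/2)` at most `Y/4`; the second uses `4 t
  -- g ≤ Y^(1 - q/2)`, as `p(1 - q/2) = 1`. Thus `2E ≤ 2te ≤ Y`, which closes the loop in the choice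
  -- of `e`.
  have hYe : ∀ t, 0 ≤ t → e t * t ≤ Y t / 2 := by
    intro t ht
    have hx : 0 ≤ t * g t := mul_nonneg ht (hgnonneg t)
    have hf0 : 0 ≤ t * f t := mul_nonneg ht (hfpos t).le
    have hYt := hY0 t ht
    have h1 : 4 * (t * g t) ≤ Y t ^ (1 - q / 2) := by
      calc 4 * (t * g t) = ((4 * (t * g t)) ^ p) ^ (1 - q / 2) := by
            rw [← Real.rpow_mul (by positivity), hpq, Real.rpow_one]
        _ ≤ Y t ^ (1 - q / 2) := by
            refine Real.rpow_le_rpow (by positivity) ?_ (by linarith)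
            simp only [hY]
            linarith
    have h2 : 4 * (t * g t) * Y t ^ (q / 2) ≤ Y t := by
      calc 4 * (t * g t) * Y t ^ (q / 2) ≤ Y t ^ (1 - q / 2) * Y t ^ (q / 2) := by gcongr
        _ = Y t := by
          rw [← Real.rpow_add' hYt (by ring_nf; norm_num)]
          ring_nf
          rw [Real.rpow_one]
    have h3 : 4 * (t * f t) ≤ Y t := by
      simp only [hY]
      have : 0 ≤ (4 * (t * g t)) ^ p := by positivity
      linarith
    simp only [he_def]
    linarith
  have hEY : ∀ t, 0 ≤ t → 2 * energy e 0 t ≤ Y t := by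
    intro t ht
    have h1 := energy_le_mul_sub he hmono ht
    rw [sub_zero] at h1
    linarith [hYe t ht]
  refine ⟨e, he, hpos, hmono, fun t ht => ?_, hEY⟩
  have hE0 : 0 ≤ energy e 0 t := intervalIntegral.integral_nonneg ht fun τ hτ => (hpos τ hτ.1).le
  rw [speed_rpow hE0]
  simp only [he_def]
  have := hgnonneg t
  gcongr
  exact hEY t ht

/-- If the Keller–Osserman integral diverges, then the motion takes infinite time. -/
theorem mem_lifespan_of_lintegral_eq_top {q : ℝ} (hq1 : q ≤ 1) {f g : ℝ → ℝ}
    (hfpos : ∀ t, 0 < f t) (hgnonneg : ∀ t, 0 ≤ g t) {e : ℝ → ℝ} (he : Continuous e)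
    (hpos : ∀ t, 0 ≤ t → 0 < e t) (hmono : MonotoneOn e (Ici 0))
    (hE : ∀ t, 0 ≤ t → 2 * energy e 0 t ≤ 4 * (t * f t) + (4 * (t * g t)) ^ (2 / (2 - q)))
    (hint : ∫⁻ t in Ioi (0 : ℝ),
      ENNReal.ofReal (1 / ((t * f t) ^ ((1 : ℝ) / 2) + (t * g t) ^ (1 / (2 - q)))) = ⊤)
    (s : ℝ) : s ∈ lifespan e 0 := by
  by_contra hs
  simp only [lifespan, Set.mem_ofPred_eq, not_exists, not_and, not_lt] at hs
  have h2q : 0 < 2 - q := by linarith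
  have hInt : IntegrableOn (fun t => (speed e 0 t)⁻¹) (Ioi 0) := by
    refine integrableOn_Ioi_of_intervalIntegral_norm_bounded |s| 0 (b := fun t : ℝ => max t 0)
      (l := atTop) (fun t => ?_) (tendsto_atTop_mono (fun t => le_max_left t 0) tendsto_id)
      (Eventually.of_forall fun t => ?_)
    · exact (intervalIntegrable_inv_speed_left he hpos hmono (le_max_right t 0)).1
    · simp only [norm_inv, Real.norm_of_nonneg (speed_nonneg _)]
      exact hs _ (le_max_right t 0)
  refine (hInt.const_mul 4).lintegral_lt_top.not_ge ?_
  rw [← hint]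
  refine setLIntegral_mono' measurableSet_Ioi fun t ht => ENNReal.ofReal_le_ofReal ?_
  have ht0 : 0 < t := ht
  have hft := hfpos t
  have hgt := hgnonneg t
  set x := (t * f t) ^ ((1 : ℝ) / 2)
  set y := (t * g t) ^ (1 / (2 - q))
  have hx0 : 0 < x := by positivity
  have hy0 : 0 ≤ y := by positivity
  have hx : x ^ 2 = t * f t := by
    rw [← Real.rpow_natCast, ← Real.rpow_mul (by positivity)]; norm_num
  have hy : (4 * (t * g t)) ^ (2 / (2 - q)) ≤ (4 * y) ^ 2 := by
    -- Here `q ≤ 1` gives `2/(2-q) ≤ 2`.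
    have h1 : (4 : ℝ) ^ (2 / (2 - q)) ≤ 4 ^ (2 : ℝ) := by
      refine Real.rpow_le_rpow_of_exponent_le (by norm_num) ?_
      rw [div_le_iff₀ h2q]
      linarith
    have h2 : y ^ 2 = (t * g t) ^ (2 / (2 - q)) := by
      rw [← Real.rpow_natCast, ← Real.rpow_mul (by positivity)]
      congr 1
      push_cast
      ring
    rw [Real.mul_rpow (by norm_num) (by positivity), mul_pow, ← h2]
    norm_num at h1 ⊢
    gcongr
  have hs : speed e 0 t ≤ 4 * (x + y) := by
    refine Real.sqrt_le_iff.2 ⟨by positivity, ?_⟩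
    have := hE t ht0.le
    rw [← hx] at this
    nlinarith [mul_nonneg hx0.le hy0]
  have hs0 := speed_pos he hpos hmono ht0
  rw [div_le_iff₀ (by positivity), mul_assoc, mul_comm _ (x + y), ← mul_assoc, ← div_eq_mul_inv,
    one_le_div hs0]
  exact hs

/-! ### Nonexistence and the equivalence. -/

/-- Nonexistence for superlinear growth in the gradient. -/
theorem not_isEntireViscositySubsolution_of_one_lt {n k : ℕ} {q : ℝ} (hq1 : 1 < q)
    {f g : ℝ → ℝ} (hfpos : ∀ t, 0 < f t) (hfmono : StrictMono f)
    (hgnonneg : ∀ t, 0 ≤ g t) (hgmono : Monotone g) (hgq : ∃ t, g t ≠ 0) (u : Rn n → ℝ) :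
    ¬ IsEntireViscositySubsolution k f g q u := by
  intro hu
  obtain ⟨t₀, ht₀⟩ := hgq
  set a := max t₀ 1
  have ha0 : 0 < a := lt_max_of_lt_right one_pos
  have hga : 0 < g a := ((hgnonneg t₀).lt_of_ne' ht₀).trans_le (hgmono (le_max_left _ _))
  -- Half of `f a` pays for the constant force, the other half for the `1` in `v^r ≤ 1 + v^q`.
  set m := min (f a / 2) (g a) with hm_def
  have hm : 0 < m := lt_min (half_pos (hfpos a)) hga
  have hmf : 2 * m ≤ f a := by linarith [min_le_left (f a / 2) (g a)]
  have hmg : m ≤ g a := min_le_right _ _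
  -- Capping below `2` keeps `1/(2-r)` meaningful even when `q = 2`, and `r > 1` makes it exceed
  -- `1`, so the integral converges.
  set r := min q (3 / 2)
  have hr1 : 1 < r := lt_min hq1 (by norm_num)
  have hrq : r ≤ q := min_le_left _ _
  have hr2 : r < 2 := (min_le_right _ _).trans_lt (by norm_num)
  have h2r : 0 < 2 - r := by linarith
  have hint : IntegrableOn
      (fun t => 1 / ((t * m) ^ ((1 : ℝ) / 2) + (t * m) ^ (1 / (2 - r)))) (Ioi a) := by
    have h1 : IntegrableOn (fun t : ℝ => t ^ (-(1 / (2 - r)))) (Ioi a) := by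
      refine integrableOn_Ioi_rpow_of_lt ?_ ha0
      rw [neg_lt_neg_iff, lt_div_iff₀ h2r]
      linarith
    refine (h1.const_mul (m ^ (1 / (2 - r)))⁻¹).mono' (by
      refine Measurable.aestronglyMeasurable ?_
      fun_prop) ?_
    refine (ae_restrict_iff' measurableSet_Ioi).2 (Eventually.of_forall fun t ht => ?_)
    have ht0 : 0 < t := ha0.trans ht
    rw [Real.norm_of_nonneg (by positivity), Real.rpow_neg ht0.le, ← mul_inv, mul_comm (m ^ _),
      ← Real.mul_rpow ht0.le hm.le, one_div]
    refine inv_anti₀ (by positivity) ?_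
    have : 0 ≤ (t * m) ^ ((1 : ℝ) / 2) := by positivity
    linarith
  obtain ⟨e, R, he, hpos, hmono, hle, hR⟩ := exists_force_travelTime_le k (zero_lt_one.trans hr1)
    hr2 (f := fun _ => m) (g := fun _ => m) continuous_const continuous_const (fun _ => hm)
    monotone_const (fun _ => hm.le) monotone_const ha0 hint
  obtain ⟨x, hx⟩ := hu.exists_lt hfpos hfmono hgnonneg a
  refine hx.not_ge (hu.le_of_travelTime_bounded (zero_lt_one.trans hq1) hfmono hgmono he hpos hmono
    (fun t ht => ?_) hR x)
  set v := speed e a t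
  have hv : 0 ≤ v := speed_nonneg t
  have hvr : v ^ r ≤ 1 + v ^ q := by
    have h0 : 0 ≤ v ^ q := by positivity
    rcases le_total v 1 with h | h
    · linarith [Real.rpow_le_one hv h (by linarith : 0 ≤ r)]
    · linarith [Real.rpow_le_rpow_of_exponent_le h hrq]
  have h1 : m * v ^ r ≤ m * (1 + v ^ q) := by gcongr
  have h2 : m * v ^ q ≤ g t * v ^ q := by
    have := hmg.trans (hgmono ht)
    gcongr
  have h3 := hfmono.monotone ht
  have h4 := hle t ht
  linarith

/-- Nonexistence when the Keller–Osserman integral converges. -/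
theorem not_isEntireViscositySubsolution_of_lintegral_ne_top {n k : ℕ} {q : ℝ} (hq0 : 0 < q)
    (hq2 : q < 2) {f g : ℝ → ℝ} (hf : Continuous f) (hg : Continuous g)
    (hfpos : ∀ t, 0 < f t) (hfmono : StrictMono f) (hgnonneg : ∀ t, 0 ≤ g t) (hgmono : Monotone g)
    (hint : ∫⁻ t in Ioi (0 : ℝ),
      ENNReal.ofReal (1 / ((t * f t) ^ ((1 : ℝ) / 2) + (t * g t) ^ (1 / (2 - q)))) ≠ ⊤)
    (u : Rn n → ℝ) : ¬ IsEntireViscositySubsolution k f g q u := by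
  intro hu
  have hI : IntegrableOn
      (fun t => 1 / ((t * f t) ^ ((1 : ℝ) / 2) + (t * g t) ^ (1 / (2 - q)))) (Ioi 0) := by
    refine (lintegral_ofReal_ne_top_iff_integrable ?_ ?_).1 hint
    · have hfm := hf.measurable
      have hgm := hg.measurable
      refine Measurable.aestronglyMeasurable ?_
      fun_prop
    · refine (ae_restrict_iff' measurableSet_Ioi).2 (Eventually.of_forall fun t ht => ?_)
      have ht0 : 0 < t := ht
      have := hfpos t
      have := hgnonneg t
      simp only [Pi.zero_apply]
      positivity
  obtain ⟨e, R, he, hpos, hmono, hle, hR⟩ := exists_force_travelTime_le k hq0 hq2 hf hg hfpos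
    hfmono.monotone hgnonneg hgmono one_pos (hI.mono_set (Ioi_subset_Ioi zero_le_one))
  obtain ⟨x, hx⟩ := hu.exists_lt hfpos hfmono hgnonneg 1
  exact hx.not_ge (hu.le_of_travelTime_bounded hq0 hfmono hgmono he hpos hmono hle hR x)

theorem mainTheorem4 (n k : ℕ) (hk : 1 ≤ k) (hkn : k ≤ n) (q : ℝ) (hq0 : 0 < q) (hq2 : q ≤ 2)
    (f g : ℝ → ℝ) (hf : Continuous f) (hg : Continuous g)
    (hfpos : ∀ t, 0 < f t) (hfmono : StrictMono f)
    (hgnonneg : ∀ t, 0 ≤ g t) (hgmono : Monotone g)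
    (hgq : 1 < q → ∃ t, g t ≠ 0) :
    (∃ u : Rn n → ℝ, IsEntireViscositySubsolution k f g q u) ↔
      q ≤ 1 ∧
        ∫⁻ t in Set.Ioi (0 : ℝ),
          ENNReal.ofReal
            (1 / ((t * f t) ^ ((1 : ℝ) / 2) + (t * (g t)⁺) ^ (1 / (2 - q)))) = ⊤ := by
  simp only [posPart_of_nonneg (hgnonneg _)]
  constructor
  · rintro ⟨u, hu⟩
    have hq1 : q ≤ 1 := by
      by_contra! hq1
      exact not_isEntireViscositySubsolution_of_one_lt hq1 hfpos hfmono hgnonneg hgmono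
        (hgq hq1) u hu
    refine ⟨hq1, ?_⟩
    by_contra hint
    exact not_isEntireViscositySubsolution_of_lintegral_ne_top hq0 (by linarith) hf hg hfpos hfmono
      hgnonneg hgmono hint u hu
  · rintro ⟨hq1, hint⟩
    obtain ⟨e, he, hpos, hmono, hle, hE⟩ := exists_force_le hq0 (by linarith) hf hg hfpos
      hfmono.monotone hgnonneg hgmono
    exact exists_isEntireViscositySubsolution hk (by omega) he hpos hmono hle
      (mem_lifespan_of_lintegral_eq_top hq1 hfpos hgnonneg he hpos hmono hE hint) hgnonneg hq0
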